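/- A (row-finite) weighted graph $(E,\omega)$ consists of countable sets $E^0$ (vertices) and $E^{\mathrm{st}}$ (structured edges), maps $s,r:E^{\mathrm{st}}\to E^0$ with every $s^{-1}(v)$ finite, and a weight map $\omega:E^{\mathrm{st}}\to\{1,2,3,\dots\}$; its edges are the symbols $\alpha_i$ with $\alpha\in E^{\mathrm{st}}$, $1\le i\le\omega(\alpha)$. For a vertex $v$ put $\omega(v)=\max\{\omega(\alpha): s(\alpha)=v\}$ ($0$ if $v$ emits no edge), and call $v$ weighted if $\omega(v)>1$. The weight forest $W\subseteq E^0$ is the set of all vertices that can be reached by a (possibly trivial) directed path from some weighted vertex. A weighted graph with at least one weighted vertex is called reducible if $|s^{-1}(v)|\le 1$ and $|r^{-1}(v)\cap s^{-1}(W)|\le 1$ for every $v\in W$, and irreducible otherwise. Let $R$ be a unital (not necessarily commutative) ring. The weighted Leavitt path algebra $L_R(E,\omega)$ is the quotient of the free (non-unital) $R$-ring on the symbols $v$ ($v\in E^0$), $\alpha_i$, $\alpha_i^*$ (elements of $R$ commuting with words) by the ideal generated by the relations 1. $vw=\delta_{vw}v$ for $v,w\in E^0$; 2. $s(\alpha)\alpha_i=\alpha_i=\alpha_i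 r(\alpha)$ and $r(\alpha)\alpha_i^*=\alpha_i^*=\alpha_i^*s(\alpha)$; 3. $\sum_{\alpha\in s^{-1}(v)}\alpha_i\alpha_j^*=\delta_{ij}v$ for $v\in E^0$, $1\le i,j\le\omega(v)$; 4. $\sum_{1\le i\le\max\{\omega(\alpha),\omega(\beta)\}}\alpha_i^*\beta_i=\delta_{\alpha\beta}\,r(\alpha)$ for $\alpha,\beta\in E^{\mathrm{st}}$, where $\alpha_i=\alpha_i^*=0$ in (3) and (4) if $i>\omega(\alpha)$. With $n=\sup_\alpha\omega(\alpha)$ it is graded by $\mathbb Z^n$ (by the direct sum of countably many copies of $\mathbb Z$ if $n=\infty$) via $\deg v=0$, $\deg\alpha_i=e_i$, $\deg\alpha_i^*=-e_i$. An ideal $J$ is called proper if $J\ne 0$ and $J\ne L_R(E,\omega)$; $L_R(E,\omega)$ is called graded simple if its multiplication is not identically zero and it has no proper graded two-sided ideal. **Proposition.** If $(E,\omega)$ is irreducible, then $L_R(E,\omega)$ is not graded simple; more precisely, if $R\neq 0$, then $L_R(E,\omega)$ has a proper graded ideal. -/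

import Mathlib

universe u v w

set_option linter.checkUnivs false in
/-- A row-finite weighted graph: countable sets of vertices and of structured edges, source and
range maps, a weight map with positive integer values; every vertex emits finitely many
structured edges. The edges `α_1, …, α_{ω(α)}` are the pairs `(α, i)` with `i : Fin (ω α)`, so that
`α_{i+1}` is `(α, i)`: indices of edges start at `0` throughout. -/
structure WeightedGraph where
  Vert : Type u
  SEdge : Type v
  src : SEdge → Vert
  rng : SEdge → Vert
  weight : SEdge → ℕ
  weight_pos : ∀ α, 0 < weight α
  countable_vert : Countable Vert
  countable_sedge : Countable SEdge
  rowFinite : ∀ v, (src ⁻¹' {v}).Finite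

namespace WeightedGraph

/-- The finite set `s⁻¹(v)` of structured edges with source `v`. -/
noncomputable def out (E : WeightedGraph.{u, v}) (v : E.Vert) : Finset E.SEdge :=
  (E.rowFinite v).toFinset

/-- `ω(v)`, the maximal weight of a structured edge with source `v` (`0` if `v` is a sink). -/
noncomputable def vertWeight (E : WeightedGraph.{u, v}) (v : E.Vert) : ℕ :=
  (E.out v).sup E.weight

/-- The set of weighted vertices. -/
def weightedVerts (E : WeightedGraph.{u, v}) : Set E.Vert := {v | 1 < E.vertWeight v}

/-- `u ≥ v`: there is a (possibly trivial) path from `u` to `v`. -/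
def Reaches (E : WeightedGraph.{u, v}) : E.Vert → E.Vert → Prop :=
  Relation.ReflTransGen fun u v => ∃ α, E.src α = u ∧ E.rng α = v

/-- The tree `T(u)` of a vertex. -/
def tree (E : WeightedGraph.{u, v}) (u : E.Vert) : Set E.Vert := {v | E.Reaches u v}

/-- The weight forest: the union of the trees of the weighted vertices. -/
def weightForest (E : WeightedGraph.{u, v}) : Set E.Vert := ⋃ u ∈ E.weightedVerts, E.tree u

/-- The local condition in the definition of reducibility: every vertex of the weight forest emits
at most one structured edge, and receives at most one from the weight forest. -/
def ForestCondition (E : WeightedGraph.{u, v}) : Prop :=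
  ∀ v ∈ E.weightForest, (E.src ⁻¹' {v}).encard ≤ 1 ∧
    (E.rng ⁻¹' {v} ∩ E.src ⁻¹' E.weightForest).encard ≤ 1

/-- Reducible weighted graphs. -/
def IsReducible (E : WeightedGraph.{u, v}) : Prop := E.weightedVerts.Nonempty ∧ E.ForestCondition

/-- Irreducible weighted graphs: those with a weighted vertex that are not reducible. -/
def IsIrreducible (E : WeightedGraph.{u, v}) : Prop := E.weightedVerts.Nonempty ∧ ¬ E.IsReducible

/-- The generators `X = E⁰ ∪ E¹ ∪ (E¹)^*`. -/
inductive Gen (E : WeightedGraph.{u, v})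
  | vert (v : E.Vert)
  | edge (α : E.SEdge) (i : Fin (E.weight α))
  | ghost (α : E.SEdge) (i : Fin (E.weight α))

/-- The free `R`-ring `R⟨X⟩` (without unit): the free left `R`-module on the nonempty words over
`X`, with `(r x) (s y) = (r s) (x y)` for `r, s ∈ R` and words `x, y`. -/
abbrev FreeRing (R : Type w) [Ring R] (E : WeightedGraph.{u, v}) : Type _ :=
  MonoidAlgebra R (FreeSemigroup E.Gen)

section Relators
variable (R : Type w) [Ring R] (E : WeightedGraph.{u, v})

/-- A generator as an element of the free `R`-ring. -/
noncomputable def gen (x : E.Gen) : FreeRing R E := MonoidAlgebra.single (FreeSemigroup.of x) 1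

/-- A vertex as an element of the free `R`-ring. -/
noncomputable def vertex (v : E.Vert) : FreeRing R E := E.gen R (.vert v)

/-- The edge `α_{i+1}` as an element of the free `R`-ring, zero if `i + 1 > ω(α)`. -/
noncomputable def edge (α : E.SEdge) (i : ℕ) : FreeRing R E :=
  if h : i < E.weight α then E.gen R (.edge α ⟨i, h⟩) else 0

/-- The ghost edge `α_{i+1}^*` as an element of the free `R`-ring, zero if `i + 1 > ω(α)`. -/
noncomputable def ghost (α : E.SEdge) (i : ℕ) : FreeRing R E :=
  if h : i < E.weight α then E.gen R (.ghost α ⟨i, h⟩) else 0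

open Classical in
/-- The elements "left hand side minus right hand side" of the defining relations of the
weighted Leavitt path algebra. -/
inductive Relator : FreeRing R E → Prop
  | vert_mul_vert (v w : E.Vert) :
      Relator (E.vertex R v * E.vertex R w - if v = w then E.vertex R v else 0)
  | src_mul_edge (α : E.SEdge) (i : ℕ) (hi : i < E.weight α) :
      Relator (E.vertex R (E.src α) * E.edge R α i - E.edge R α i)
  | edge_mul_rng (α : E.SEdge) (i : ℕ) (hi : i < E.weight α) :
      Relator (E.edge R α i * E.vertex R (E.rng α) - E.edge R α i)
  | rng_mul_ghost (α : E.SEdge) (i : ℕ) (hi : i < E.weight α) :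
      Relator (E.vertex R (E.rng α) * E.ghost R α i - E.ghost R α i)
  | ghost_mul_src (α : E.SEdge) (i : ℕ) (hi : i < E.weight α) :
      Relator (E.ghost R α i * E.vertex R (E.src α) - E.ghost R α i)
  | edge_mul_ghost (v : E.Vert) (i j : ℕ) (hi : i < E.vertWeight v) (hj : j < E.vertWeight v) :
      Relator (∑ α ∈ E.out v, E.edge R α i * E.ghost R α j - if i = j then E.vertex R v else 0)
  | ghost_mul_edge (α β : E.SEdge) :
      Relator (∑ i ∈ Finset.range (max (E.weight α) (E.weight β)),
        E.ghost R α i * E.edge R β i - if α = β then E.vertex R (E.rng α) else 0)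

/-- The ideal of the `R`-ring `R⟨X⟩` (that is, the two-sided ideal which is an `R`-subbimodule)
generated by the relators. Since scalars and words commute in `R⟨X⟩`, it is the ideal of the ring
`R⟨X⟩` generated by the elements `r y s = (r • y) <• s` for `r, s ∈ R` and relators `y`. -/
noncomputable def relIdeal : TwoSidedIdeal (FreeRing R E) :=
  TwoSidedIdeal.span {z | ∃ (r s : R) (y : FreeRing R E),
    E.Relator R y ∧ z = MulOpposite.op s • (r • y)}

theorem smul_mem_relIdeal (t : R) {x : FreeRing R E} (hx : x ∈ E.relIdeal R) :
    t • x ∈ E.relIdeal R := by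
  refine TwoSidedIdeal.span_induction (p := fun x _ => t • x ∈ E.relIdeal R) ?_ ?_ ?_ ?_ ?_ ?_ hx
  · rintro x ⟨r, s, y, hy, rfl⟩
    refine TwoSidedIdeal.subset_span ⟨t * r, s, y, hy, ?_⟩
    rw [smul_comm, smul_smul]
  · rw [smul_zero]; exact (E.relIdeal R).zero_mem
  · intro x y _ _ hx hy
    rw [smul_add]; exact (E.relIdeal R).add_mem hx hy
  · intro x _ hx
    rw [smul_neg]; exact (E.relIdeal R).neg_mem hx
  · intro a x hx _
    rw [← smul_mul_assoc]; exact (E.relIdeal R).mul_mem_left _ _ hx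
  · intro b x _ hx
    rw [← smul_mul_assoc]; exact (E.relIdeal R).mul_mem_right _ _ hx

theorem op_smul_mem_relIdeal (t : R) {x : FreeRing R E} (hx : x ∈ E.relIdeal R) :
    MulOpposite.op t • x ∈ E.relIdeal R := by
  refine TwoSidedIdeal.span_induction
    (p := fun x _ => MulOpposite.op t • x ∈ E.relIdeal R) ?_ ?_ ?_ ?_ ?_ ?_ hx
  · rintro x ⟨r, s, y, hy, rfl⟩
    refine TwoSidedIdeal.subset_span ⟨r, s * t, y, hy, ?_⟩
    rw [smul_smul, MulOpposite.op_mul]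
  · rw [smul_zero]; exact (E.relIdeal R).zero_mem
  · intro x y _ _ hx hy
    rw [smul_add]; exact (E.relIdeal R).add_mem hx hy
  · intro x _ hx
    rw [smul_neg]; exact (E.relIdeal R).neg_mem hx
  · intro a x _ hx
    rw [← mul_smul_comm]; exact (E.relIdeal R).mul_mem_left _ _ hx
  · intro b x hx _
    rw [← mul_smul_comm]; exact (E.relIdeal R).mul_mem_right _ _ hx

/-- The weighted Leavitt path algebra `L_R(E, ω) = R⟨X⟩ / I`, a ring without unit in general. -/
abbrev LeavittPathRing : Type _ := (E.relIdeal R).ringCon.Quotient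

/-- The projection `R⟨X⟩ → L_R(E, ω)`. -/
noncomputable def proj (x : FreeRing R E) : LeavittPathRing R E := (x : (E.relIdeal R).ringCon.Quotient)

/-- The left `R`-module structure of `L_R(E, ω)`, `r • [x] = [r • x]`. -/
noncomputable instance instModuleLeavittPathRing : Module R (LeavittPathRing R E) where
  smul r := Quotient.map' (fun x => r • x) fun x y h => by
    have h' := ((E.relIdeal R).rel_iff x y).1 h
    refine ((E.relIdeal R).rel_iff (r • x) (r • y)).2 ?_
    rw [← smul_sub]; exact E.smul_mem_relIdeal R r h'
  one_smul := by rintro ⟨x⟩; exact congrArg (E.proj R) (one_smul R x)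
  mul_smul r s := by rintro ⟨x⟩; exact congrArg (E.proj R) (mul_smul r s x)
  smul_zero r := congrArg (E.proj R) (smul_zero r)
  smul_add r := by rintro ⟨x⟩ ⟨y⟩; exact congrArg (E.proj R) (smul_add r x y)
  add_smul r s := by rintro ⟨x⟩; exact congrArg (E.proj R) (add_smul r s x)
  zero_smul := by rintro ⟨x⟩; exact congrArg (E.proj R) (zero_smul R x)

end Relators

section Grading
variable (E : WeightedGraph.{u, v})

/-- The indices of edges. These are the first `n` natural numbers, where `n ∈ ℕ ∪ {∞}` is the
supremum of the weights of all structured edges. -/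
abbrev EdgeIndex : Type := {i : ℕ // ∃ α, i < E.weight α}

/-- The grading group `ℤⁿ` (the direct sum of countably many copies of `ℤ` if `n = ∞`). -/
abbrev GradingGroup : Type := E.EdgeIndex →₀ ℤ

/-- The degree of a generator: `0` for vertices, `eᵢ` for `αᵢ`, and `-eᵢ` for `αᵢ^*`. -/
noncomputable def genDegree : E.Gen → E.GradingGroup
  | .vert _ => 0
  | .edge α i => Finsupp.single ⟨i, α, i.isLt⟩ 1
  | .ghost α i => -Finsupp.single ⟨i, α, i.isLt⟩ 1

/-- The degree of a word: the sum of the degrees of its letters. -/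
noncomputable def wordDegree (x : FreeSemigroup E.Gen) : E.GradingGroup :=
  E.genDegree x.head + (x.tail.map E.genDegree).sum

variable (R : Type w) [Ring R]

/-- The homogeneous component of degree `g` of `L_R(E, ω)`: the `R`-span of the images of the
words of degree `g`. -/
noncomputable def component (g : E.GradingGroup) : Submodule R (LeavittPathRing R E) :=
  Submodule.span R
    {a | ∃ x : FreeSemigroup E.Gen, E.wordDegree x = g ∧ a = E.proj R (MonoidAlgebra.single x 1)}

variable {R}

/-- A graded ideal of `L_R(E, ω)`: a two-sided ideal `J` every element of which is a sum of
homogeneous elements of `J`. -/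
def IsGradedIdeal (J : TwoSidedIdeal (LeavittPathRing R E)) : Prop :=
  ∀ a ∈ J, a ∈ AddSubgroup.closure {b | b ∈ J ∧ ∃ g, b ∈ E.component R g}

/-- A proper ideal of `L_R(E, ω)`: one different from zero and from the whole ring. -/
def IsProperIdeal (J : TwoSidedIdeal (LeavittPathRing R E)) : Prop := J ≠ ⊥ ∧ J ≠ ⊤

variable (R)

/-- `L_R(E, ω)` is graded simple: its multiplication is not identically zero and it has no proper
graded ideal. -/
def IsGradedSimple : Prop :=
  (∃ a b : LeavittPathRing R E, a * b ≠ 0) ∧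
    ¬ ∃ J : TwoSidedIdeal (LeavittPathRing R E), E.IsGradedIdeal J ∧ E.IsProperIdeal J

end Grading

end WeightedGraph

namespace WeightedGraph

/-! A homogeneous element generates a graded ideal, so it suffices to find one word `x` whose image
is nonzero and generates a proper ideal. Both are detected by representations. A choice at every
vertex `v` of a bijection from `s⁻¹(v) × ℕ` onto `ℕ × {0, …, ω(v) - 1}`, sending `α` into indices
below `ω(α)`, makes the generators act on `E⁰ × ℕ` by partial injections, hence makes the Leavitt
path algebra act on `R`-valued functions. If `x` acts as zero for one choice and not for another,
the ideal of `x` is nonzero and lies in the kernel of the first action, which contains no vertex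
(`exists_isGradedIdeal_isProperIdeal`).

There is room for different choices because of weighted vertices: following only edges of index 1
from such a vertex reaches infinitely many points and misses infinitely many (`infinite_mark`), as
long as no branching occurs on the way. If the forest branches, take a shortest trail to a branching
vertex: the word "trail, then `α₁`" is zero or nonzero according to whether the range of `α` avoids
or meets the points reached (`exists_properIdeal_of_branching`). If it never branches, two edges `α
≠ β` from the forest have the same range: for `x` the path through `α` times the adjoint of the path
through `β`, the two sets of endpoints can be made disjoint or equal by changing the bijection at
`s(β)` (`exists_properIdeal_of_merging`). -/

theorem mem_out {E : WeightedGraph.{u, v}} {v : E.Vert} {α : E.SEdge} :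
    α ∈ E.out v ↔ E.src α = v := by
  simp [out]

/-! ### Branching systems and the partial injections they define -/

/-- A bijection between `s⁻¹(v) × ℕ` and `ℕ × {0, …, ω(v) - 1}` which maps `{α} × ℕ` to
`ℕ × {0, …, ω(α) - 1}`. -/
structure LocalSystem (E : WeightedGraph.{u, v}) (v : E.Vert) where
  toFun : E.SEdge → ℕ → ℕ × ℕ
  lt : ∀ α t, E.src α = v → (toFun α t).2 < E.weight α
  inj : ∀ α β t t', E.src α = v → E.src β = v → toFun α t = toFun β t' → α = β ∧ t = t'
  surj : ∀ s i, i < E.vertWeight v → ∃ α t, E.src α = v ∧ toFun α t = (s, i)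

/-- A choice of a local system at every vertex. It makes `E.Vert × ℕ` a branching system, on which
the generators of the weighted Leavitt path algebra act by partial injections. -/
abbrev BranchingSystem (E : WeightedGraph.{u, v}) : Type _ := ∀ v, LocalSystem E v

namespace BranchingSystem

variable {E : WeightedGraph.{u, v}} (S : BranchingSystem E)

/-- The branch along the structured edge `α`. -/
def branch (α : E.SEdge) (t : ℕ) : ℕ × ℕ := (S (E.src α)).toFun α t

theorem branch_lt (α : E.SEdge) (t : ℕ) : (S.branch α t).2 < E.weight α := (S _).lt α t rfl

variable {S} in
theorem branch_inj {α β : E.SEdge} {t t' : ℕ} (hs : E.src α = E.src β)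
    (h : S.branch α t = S.branch β t') : α = β ∧ t = t' := by
  refine (S (E.src β)).inj α β t t' hs rfl ?_
  rw [branch, branch, hs] at h
  exact h

theorem exists_branch_eq (v : E.Vert) (s i : ℕ) (hi : i < E.vertWeight v) :
    ∃ α t, E.src α = v ∧ S.branch α t = (s, i) := by
  obtain ⟨α, t, rfl, h⟩ := (S v).surj s i hi
  exact ⟨α, t, rfl, h⟩

open Classical in
/-- The action of the generators on points. -/
noncomputable def step : E.Gen → E.Vert × ℕ → Option (E.Vert × ℕ)
  | .vert v, p => if p.1 = v then some p else none
  | .edge α i, p => if h : ∃ t, p.1 = E.src α ∧ S.branch α t = (p.2, i.1) then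
      some (E.rng α, h.choose) else none
  | .ghost α i, p => if p.1 = E.rng α ∧ (S.branch α p.2).2 = i then
      some (E.src α, (S.branch α p.2).1) else none

theorem step_edge_eq_some {α : E.SEdge} {i : Fin (E.weight α)} {p q : E.Vert × ℕ} :
    S.step (.edge α i) p = some q ↔
      p.1 = E.src α ∧ q.1 = E.rng α ∧ S.branch α q.2 = (p.2, i.1) := by
  rw [step]
  split_ifs with h
  · constructor
    · intro hq
      obtain rfl := Option.some_injective _ hq
      exact ⟨h.choose_spec.1, rfl, h.choose_spec.2⟩
    · rintro ⟨-, h1, h2⟩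
      exact congrArg some (Prod.ext h1.symm
        (branch_inj rfl (h.choose_spec.2.trans h2.symm)).2)
  · simp only [false_iff]
    rintro ⟨h1, -, h2⟩
    exact h ⟨q.2, h1, h2⟩

theorem step_ghost_eq_some {α : E.SEdge} {i : Fin (E.weight α)} {p q : E.Vert × ℕ} :
    S.step (.ghost α i) p = some q ↔
      p.1 = E.rng α ∧ q.1 = E.src α ∧ S.branch α p.2 = (q.2, i.1) := by
  rw [step]
  split_ifs with h
  · rw [Option.some_inj]
    constructor
    · rintro rfl
      exact ⟨h.1, rfl, Prod.ext rfl h.2⟩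
    · rintro ⟨-, h1, h2⟩
      exact Prod.ext h1.symm (by rw [h2])
  · simp only [false_iff]
    rintro ⟨h1, -, h2⟩
    exact h ⟨h1, by rw [h2]⟩

/-! ### The action on functions, and the defining relations -/

variable (R : Type w) [Ring R]

/-- The operator on functions given by pulling back along a partial map. -/
def pullback {T : Type*} (g : T → Option T) : AddMonoid.End (T → R) where
  toFun f p := (g p).elim 0 f
  map_zero' := by ext p; cases h : g p <;> simp
  map_add' f f' := by ext p; cases h : g p <;> simp [h]

variable {R} in
@[simp] theorem pullback_apply {T : Type*} (g : T → Option T) (f : T → R) (p : T) :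
    pullback R g f p = (g p).elim 0 f := rfl

/-- Left multiplication by scalars on functions. -/
def scalar (T : Type*) : R →+* AddMonoid.End (T → R) := Module.toAddMonoidEnd R (T → R)

/-- Scalars multiply values while a pullback only moves points. This is what lets a noncommutative
`R` act compatibly with the rule `(r x)(s y) = (r s)(x y)`. -/
theorem commute_scalar_pullback {T : Type*} (r : R) (g : T → Option T) :
    Commute (scalar R T r) (pullback R g) := by
  ext f p
  change r * (g p).elim 0 f = (g p).elim 0 (fun q => r * f q)
  cases g p <;> simp

/-- The action of words on functions. -/
noncomputable def wordAction : FreeSemigroup E.Gen →ₙ* AddMonoid.End (E.Vert × ℕ → R) :=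
  FreeSemigroup.lift fun x => pullback R (S.step x)

theorem commute_scalar_wordAction (r : R) (x : FreeSemigroup E.Gen) :
    Commute (scalar R _ r) (S.wordAction R x) := by
  induction x using FreeSemigroup.recOnMul with
  | ih1 x => simpa [wordAction] using commute_scalar_pullback R r (S.step x)
  | ih2 x y hx hy => rw [map_mul]; exact hx.mul_right hy

/-- The additive map underlying the action of the free `R`-ring on functions. -/
noncomputable def additiveAction : FreeRing R E →+ AddMonoid.End (E.Vert × ℕ → R) :=
  MonoidAlgebra.liftNC (scalar R (E.Vert × ℕ)).toAddMonoidHom (S.wordAction R)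

theorem additiveAction_single (x : FreeSemigroup E.Gen) (r : R) :
    S.additiveAction R (MonoidAlgebra.single x r) = scalar R _ r * S.wordAction R x :=
  MonoidAlgebra.liftNC_single _ _ _ _

theorem additiveAction_mul (a b : FreeRing R E) :
    S.additiveAction R (a * b) = S.additiveAction R a * S.additiveAction R b := by
  induction a using MonoidAlgebra.induction_linear with
  | zero => rw [zero_mul, map_zero, zero_mul]
  | add x y hx hy => rw [add_mul, map_add, map_add, hx, hy, add_mul]
  | single x r =>
    induction b using MonoidAlgebra.induction_linear with
    | zero => rw [mul_zero, map_zero, mul_zero]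
    | add x y hx hy => rw [mul_add, map_add, map_add, hx, hy, mul_add]
    | single y s =>
      rw [MonoidAlgebra.single_mul_single, additiveAction_single, additiveAction_single,
        additiveAction_single, map_mul, map_mul, mul_assoc, mul_assoc,
        (S.commute_scalar_wordAction R s x).left_comm]

/-- The action of the free `R`-ring on functions. -/
noncomputable def action : FreeRing R E →ₙ+* AddMonoid.End (E.Vert × ℕ → R) where
  toFun := S.additiveAction R
  map_zero' := map_zero _
  map_add' := map_add _
  map_mul' := S.additiveAction_mul R

theorem action_single (x : FreeSemigroup E.Gen) (r : R) :
    S.action R (MonoidAlgebra.single x r) = scalar R _ r * S.wordAction R x :=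
  S.additiveAction_single R x r

theorem action_single_one (x : FreeSemigroup E.Gen) :
    S.action R (MonoidAlgebra.single x 1) = S.wordAction R x := by
  rw [action_single, map_one, one_mul]

theorem action_smul (r : R) (y : FreeRing R E) :
    S.action R (r • y) = scalar R _ r * S.action R y := by
  induction y using MonoidAlgebra.induction_linear with
  | zero => simp
  | add x y hx hy => rw [smul_add, map_add, map_add, hx, hy, mul_add]
  | single x s => rw [MonoidAlgebra.smul_single, action_single, action_single, smul_eq_mul,
      map_mul, mul_assoc]

/-- Words commute with scalars, so a right scalar can be moved past the word. Together with
`action_smul` this handles the bimodule generators `r y s` of `relIdeal`. -/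
theorem action_op_smul (s : R) (y : FreeRing R E) :
    S.action R (MulOpposite.op s • y) = S.action R y * scalar R _ s := by
  induction y using MonoidAlgebra.induction_linear with
  | zero => simp
  | add x y hx hy => rw [smul_add, map_add, map_add, hx, hy, add_mul]
  | single x r => rw [MonoidAlgebra.smul_single, action_single, action_single, op_smul_eq_mul,
      map_mul, mul_assoc, mul_assoc, (S.commute_scalar_wordAction R s x).eq]

variable {R}

theorem action_gen_apply (x : E.Gen) (f : E.Vert × ℕ → R) (p : E.Vert × ℕ) :
    S.action R (E.gen R x) f p = (S.step x p).elim 0 f := by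
  rw [gen, action_single_one, wordAction, FreeSemigroup.lift_of, pullback_apply]

open Classical in
theorem action_vertex_apply (v : E.Vert) (f : E.Vert × ℕ → R) (p : E.Vert × ℕ) :
    S.action R (E.vertex R v) f p = if p.1 = v then f p else 0 := by
  rw [vertex, action_gen_apply, step]
  split_ifs <;> rfl

theorem action_edge_apply {α : E.SEdge} {i s t : ℕ} (h : S.branch α t = (s, i))
    (f : E.Vert × ℕ → R) :
    S.action R (E.edge R α i) f (E.src α, s) = f (E.rng α, t) := by
  have hi : i < E.weight α := by simpa [h] using S.branch_lt α t
  rw [edge, dif_pos hi, action_gen_apply,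
    S.step_edge_eq_some (q := (E.rng α, t)) |>.2 ⟨rfl, rfl, h⟩, Option.elim_some]

theorem action_edge_apply_eq_zero {α : E.SEdge} {i : ℕ} {p : E.Vert × ℕ}
    (h : p.1 = E.src α → ∀ t, S.branch α t ≠ (p.2, i)) (f : E.Vert × ℕ → R) :
    S.action R (E.edge R α i) f p = 0 := by
  rw [edge]
  split_ifs with hi
  · rw [action_gen_apply]
    cases hq : S.step (.edge α ⟨i, hi⟩) p with
    | none => rfl
    | some q =>
      obtain ⟨h1, -, h2⟩ := S.step_edge_eq_some.1 hq
      exact (h h1 _ h2).elim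
  · rw [map_zero]; rfl

open Classical in
theorem action_ghost_apply (α : E.SEdge) (i : ℕ) (f : E.Vert × ℕ → R) (p : E.Vert × ℕ) :
    S.action R (E.ghost R α i) f p =
      if p.1 = E.rng α ∧ (S.branch α p.2).2 = i then f (E.src α, (S.branch α p.2).1) else 0 := by
  rw [ghost]
  split_ifs with hi h h
  · rw [action_gen_apply, step, if_pos h, Option.elim_some]
  · rw [action_gen_apply, step, if_neg h, Option.elim_none]
  · exact (hi (h.2 ▸ S.branch_lt α p.2)).elim
  · rw [map_zero]; rfl

theorem action_mul_apply (a b : FreeRing R E) (f : E.Vert × ℕ → R) :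
    S.action R (a * b) f = S.action R a (S.action R b f) := by
  rw [map_mul]; rfl

theorem action_sub_apply (a b : FreeRing R E) (f : E.Vert × ℕ → R) (p : E.Vert × ℕ) :
    S.action R (a - b) f p = S.action R a f p - S.action R b f p := by
  rw [map_sub]; rfl

theorem action_sum_apply {ι : Type*} (s : Finset ι) (a : ι → FreeRing R E)
    (f : E.Vert × ℕ → R) (p : E.Vert × ℕ) :
    S.action R (∑ i ∈ s, a i) f p = ∑ i ∈ s, S.action R (a i) f p := by
  classical
  induction s using Finset.induction_on with
  | empty => rw [Finset.sum_empty, Finset.sum_empty, map_zero]; rfl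
  | insert i s hi ih => rw [Finset.sum_insert hi, Finset.sum_insert hi, map_add, ← ih]; rfl

/-- The two summation relations mirror bijectivity: surjectivity gives each `(s, i)` an outgoing
edge, and injectivity makes it unique and lets a ghost followed by an edge return only along the
same structured edge. -/
theorem action_relator {y : FreeRing R E} (hy : E.Relator R y) : S.action R y = 0 := by
  classical
  ext f p
  change _ = (0 : R)
  cases hy with
  | vert_mul_vert v w =>
    rw [action_sub_apply, action_mul_apply, action_vertex_apply, action_vertex_apply]
    by_cases h : v = w
    · subst h
      rw [if_pos rfl, action_vertex_apply]
      split_ifs <;> simp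
    · rw [if_neg h, map_zero]
      change _ - (0 : R) = 0
      split_ifs with h1 h2 <;> simp
      exact (h (h1.symm.trans h2)).elim
  | src_mul_edge α i hi =>
    rw [action_sub_apply, action_mul_apply, action_vertex_apply]
    split_ifs with h
    · rw [sub_self]
    · rw [S.action_edge_apply_eq_zero fun h' => (h h').elim, sub_self]
  | edge_mul_rng α i hi =>
    rw [action_sub_apply, action_mul_apply]
    by_cases h : p.1 = E.src α ∧ ∃ t, S.branch α t = (p.2, i)
    · obtain ⟨h1, t, ht⟩ := h
      obtain ⟨u, s⟩ := p
      obtain rfl : u = E.src α := h1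
      rw [S.action_edge_apply ht, S.action_edge_apply ht, action_vertex_apply, if_pos rfl,
        sub_self]
    · have h' : p.1 = E.src α → ∀ t, S.branch α t ≠ (p.2, i) := fun h1 t ht => h ⟨h1, t, ht⟩
      rw [S.action_edge_apply_eq_zero h', S.action_edge_apply_eq_zero h', sub_self]
  | rng_mul_ghost α i hi =>
    rw [action_sub_apply, action_mul_apply, action_vertex_apply]
    split_ifs with h
    · rw [sub_self]
    · rw [action_ghost_apply, if_neg fun h' => h h'.1, sub_self]
  | ghost_mul_src α i hi =>
    rw [action_sub_apply, action_mul_apply, action_ghost_apply, action_ghost_apply,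
      action_vertex_apply, if_pos rfl, sub_self]
  | edge_mul_ghost v i j hi hj =>
    rw [action_sub_apply, action_sum_apply]
    simp only [action_mul_apply]
    obtain ⟨u, s⟩ := p
    by_cases hu : u = v
    · subst hu
      obtain ⟨α, t, rfl, ht⟩ := S.exists_branch_eq u s i hi
      -- Only the edge whose branch contains `(s, i)` moves the point; the ghost then brings it back
      -- to `s`, but with index `i`, so `j = i` is needed.
      rw [Finset.sum_eq_single α]
      · rw [S.action_edge_apply ht, action_ghost_apply, ht]
        by_cases hij : i = j
        · simp [hij, action_vertex_apply]
        · simp [hij]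
      · intro β hβ hne
        refine S.action_edge_apply_eq_zero (fun _ t' ht' => hne ?_) _
        exact (branch_inj (mem_out.1 hβ) (ht'.trans ht.symm)).1
      · exact fun h => (h (mem_out.2 rfl)).elim
    · rw [Finset.sum_eq_zero]
      · split_ifs with hij
        · rw [action_vertex_apply, if_neg hu, sub_zero]
        · simp
      · intro α hα
        refine S.action_edge_apply_eq_zero (fun h => (hu ?_).elim) _
        exact h.trans (mem_out.1 hα)
  | ghost_mul_edge α β =>
    rw [action_sub_apply, action_sum_apply]
    simp only [action_mul_apply, action_ghost_apply]
    obtain ⟨u, t⟩ := p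
    by_cases hu : u = E.rng α
    · subst hu
      -- The point `t` has exactly one incoming index along `α`, and that index is below `ω(α)`,
      -- hence in the range of summation.
      rw [Finset.sum_eq_single (S.branch α t).2]
      · rw [if_pos ⟨rfl, rfl⟩]
        dsimp only
        by_cases h : α = β
        · subst h
          have ht : S.branch α t = ((S.branch α t).1, (S.branch α t).2) := rfl
          rw [S.action_edge_apply ht, if_pos rfl, action_vertex_apply, if_pos rfl,
            sub_self]
        · rw [if_neg h, S.action_edge_apply_eq_zero]
          · simp
          · intro hs t' ht'
            exact h (branch_inj hs ht'.symm).1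
      · intro i _ hne
        rw [if_neg fun h => hne h.2.symm]
      · intro h
        refine (h (Finset.mem_range.2 (lt_max_of_lt_left (S.branch_lt α t)))).elim
    · rw [Finset.sum_eq_zero]
      · split_ifs with hij
        · rw [action_vertex_apply, if_neg hu, sub_zero]
        · simp
      · intro i _
        rw [if_neg fun h => hu h.1]

theorem action_eq_zero_of_mem_relIdeal {x : FreeRing R E} (hx : x ∈ E.relIdeal R) :
    S.action R x = 0 := by
  have h : E.relIdeal R ≤ TwoSidedIdeal.ker (S.action R) := by
    refine TwoSidedIdeal.span_le.2 ?_
    rintro _ ⟨r, s, y, hy, rfl⟩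
    refine (TwoSidedIdeal.mem_ker _).2 ?_
    rw [action_op_smul, action_smul, S.action_relator hy, mul_zero, zero_mul]
  exact (TwoSidedIdeal.mem_ker _).1 (h hx)

end BranchingSystem

/-! ### Homogeneous elements and reduction to a single word -/

section Grading

variable {E : WeightedGraph.{u, v}} {R : Type w} [Ring R]

theorem proj_mul (x y : FreeRing R E) : E.proj R (x * y) = E.proj R x * E.proj R y := rfl

theorem proj_add (x y : FreeRing R E) : E.proj R (x + y) = E.proj R x + E.proj R y := rfl

theorem proj_smul (r : R) (x : FreeRing R E) : E.proj R (r • x) = r • E.proj R x := rfl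

theorem proj_zero : E.proj R 0 = 0 := rfl

theorem proj_surjective : Function.Surjective (E.proj R) := Quotient.mk''_surjective

theorem proj_single (x : FreeSemigroup E.Gen) (r : R) :
    E.proj R (MonoidAlgebra.single x r) = r • E.proj R (MonoidAlgebra.single x 1) := by
  change _ = E.proj R (r • MonoidAlgebra.single x 1)
  rw [MonoidAlgebra.smul_single, smul_eq_mul, mul_one]

theorem wordDegree_mul (x y : FreeSemigroup E.Gen) :
    E.wordDegree (x * y) = E.wordDegree x + E.wordDegree y := by
  simp [wordDegree, add_assoc]

theorem proj_single_mem_component (x : FreeSemigroup E.Gen) (r : R) :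
    E.proj R (MonoidAlgebra.single x r) ∈ E.component R (E.wordDegree x) := by
  rw [proj_single]
  exact Submodule.smul_mem _ _ (Submodule.subset_span ⟨x, rfl, rfl⟩)

theorem single_mul_smul (x : FreeSemigroup E.Gen) (r s : R) (y : FreeRing R E) :
    MonoidAlgebra.single x r * (s • y) = MonoidAlgebra.single x (r * s) * y := by
  induction y using MonoidAlgebra.induction_linear with
  | zero => rw [smul_zero, mul_zero, mul_zero]
  | add y z hy hz => rw [smul_add, mul_add, mul_add, hy, hz]
  | single y t => rw [MonoidAlgebra.smul_single, MonoidAlgebra.single_mul_single,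
      MonoidAlgebra.single_mul_single, smul_eq_mul, mul_assoc]

/-- Left multiplication by `r x` need not be `R`-linear for noncommutative `R`; a scalar `s` in the
second factor is absorbed into the coefficient as `r s`, so `r` has to vary in the induction. -/
theorem proj_single_mul_mem_component (x : FreeSemigroup E.Gen) (r : R) {g : E.GradingGroup}
    {a : LeavittPathRing R E} (ha : a ∈ E.component R g) :
    E.proj R (MonoidAlgebra.single x r) * a ∈ E.component R (E.wordDegree x + g) := by
  induction ha using Submodule.span_induction generalizing r with
  | mem a ha =>
    obtain ⟨y, rfl, rfl⟩ := ha
    rw [← proj_mul, MonoidAlgebra.single_mul_single, ← wordDegree_mul]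
    exact proj_single_mem_component _ _
  | zero => rw [mul_zero]; exact Submodule.zero_mem _
  | add a b _ _ ha hb => rw [mul_add]; exact Submodule.add_mem _ (ha r) (hb r)
  | smul s a _ ha =>
    obtain ⟨y, rfl⟩ := proj_surjective a
    rw [← proj_smul, ← proj_mul, single_mul_smul, proj_mul]
    exact ha (r * s)

theorem mul_proj_single_mem_component (x : FreeSemigroup E.Gen) (r : R) {g : E.GradingGroup}
    {a : LeavittPathRing R E} (ha : a ∈ E.component R g) :
    a * E.proj R (MonoidAlgebra.single x r) ∈ E.component R (g + E.wordDegree x) := by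
  induction ha using Submodule.span_induction with
  | mem a ha =>
    obtain ⟨y, rfl, rfl⟩ := ha
    rw [← proj_mul, MonoidAlgebra.single_mul_single, ← wordDegree_mul]
    exact proj_single_mem_component _ _
  | zero => rw [zero_mul]; exact Submodule.zero_mem _
  | add a b _ _ ha hb => rw [add_mul]; exact Submodule.add_mem _ ha hb
  | smul s a _ ha =>
    obtain ⟨y, rfl⟩ := proj_surjective a
    rw [← proj_smul, ← proj_mul, smul_mul_assoc, proj_smul]
    exact Submodule.smul_mem _ _ ha

/-- An ideal generated by a homogeneous element is graded. -/
theorem isGradedIdeal_span_singleton {g : E.GradingGroup} {a : LeavittPathRing R E}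
    (ha : a ∈ E.component R g) : E.IsGradedIdeal (TwoSidedIdeal.span {a}) := by
  set J := TwoSidedIdeal.span {a} with hJ
  set H := AddSubgroup.closure {b | b ∈ J ∧ ∃ g, b ∈ E.component R g} with hH
  -- Every element is a sum of monomials, and a monomial times a homogeneous element of `J` is again
  -- a homogeneous element of `J`.
  have left (b : LeavittPathRing R E) {c} (hc : c ∈ H) : b * c ∈ H := by
    obtain ⟨y, rfl⟩ := proj_surjective b
    induction hc using AddSubgroup.closure_induction with
    | mem c hc =>
      obtain ⟨hcJ, g, hg⟩ := hc
      induction y using MonoidAlgebra.induction_linear with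
      | zero => rw [proj_zero, zero_mul]; exact zero_mem _
      | add y z hy hz => rw [proj_add, add_mul]; exact add_mem hy hz
      | single x r =>
        exact AddSubgroup.subset_closure
          ⟨J.mul_mem_left _ _ hcJ, _, proj_single_mul_mem_component x r hg⟩
    | zero => rw [mul_zero]; exact zero_mem _
    | add c d _ _ hc hd => rw [mul_add]; exact add_mem hc hd
    | neg c _ hc => rw [mul_neg]; exact neg_mem hc
  have right (b : LeavittPathRing R E) {c} (hc : c ∈ H) : c * b ∈ H := by
    obtain ⟨y, rfl⟩ := proj_surjective b
    induction hc using AddSubgroup.closure_induction with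
    | mem c hc =>
      obtain ⟨hcJ, g, hg⟩ := hc
      induction y using MonoidAlgebra.induction_linear with
      | zero => rw [proj_zero, mul_zero]; exact zero_mem _
      | add y z hy hz => rw [proj_add, mul_add]; exact add_mem hy hz
      | single x r =>
        exact AddSubgroup.subset_closure
          ⟨J.mul_mem_right _ _ hcJ, _, mul_proj_single_mem_component x r hg⟩
    | zero => rw [zero_mul]; exact zero_mem _
    | add c d _ _ hc hd => rw [add_mul]; exact add_mem hc hd
    | neg c _ hc => rw [neg_mul]; exact neg_mem hc
  intro b hb
  refine TwoSidedIdeal.span_induction (p := fun b _ => b ∈ H) ?_ (zero_mem H)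
    (fun _ _ _ _ hx hy => add_mem hx hy) (fun _ _ hx => neg_mem hx)
    (fun b _ _ hx => left b hx) (fun b _ _ hx => right b hx) hb
  rintro _ rfl
  exact AddSubgroup.subset_closure ⟨TwoSidedIdeal.subset_span rfl, g, ha⟩

/-- A word that acts as zero on one branching system but not on another generates a proper graded
ideal. -/
theorem exists_isGradedIdeal_isProperIdeal [Nontrivial R] (v : E.Vert) (S S' : BranchingSystem E)
    (x : FreeSemigroup E.Gen) (hS : S.wordAction R x = 0) (hS' : S'.wordAction R x ≠ 0) :
    ∃ J : TwoSidedIdeal (LeavittPathRing R E), E.IsGradedIdeal J ∧ E.IsProperIdeal J := by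
  -- The whole ideal of `x` is annihilated by the action of `S`, tested on arbitrary representatives
  -- in the free ring.
  have key {b : FreeRing R E} (hb : E.proj R b ∈
      TwoSidedIdeal.span {E.proj R (MonoidAlgebra.single x 1)}) : S.action R b = 0 := by
    obtain ⟨c, hc⟩ : ∃ c, c = E.proj R b := ⟨_, rfl⟩
    rw [← hc] at hb
    have hzero {b b' : FreeRing R E} (h : E.proj R b = E.proj R b') :
        S.action R b = S.action R b' := by
      rw [← sub_eq_zero, ← map_sub]
      refine S.action_eq_zero_of_mem_relIdeal ?_
      exact ((E.relIdeal R).rel_iff _ _).1 (Quotient.exact h)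
    refine TwoSidedIdeal.span_induction
      (p := fun c _ => ∀ b, c = E.proj R b → S.action R b = 0) ?_ ?_ ?_ ?_ ?_ ?_ hb b hc
    · rintro _ rfl b hb
      rw [← hzero hb, S.action_single_one, hS]
    · intro b hb
      rw [← hzero (proj_zero.trans hb), map_zero]
    · rintro y z _ _ hy hz b hb
      obtain ⟨y, rfl⟩ := proj_surjective y
      obtain ⟨z, rfl⟩ := proj_surjective z
      rw [← hzero ((proj_add y z).trans hb), map_add, hy y rfl, hz z rfl, add_zero]
    · rintro y _ hy b hb
      obtain ⟨y, rfl⟩ := proj_surjective y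
      rw [← hzero (b := -y) hb, map_neg, hy y rfl, neg_zero]
    · rintro a y _ hy b hb
      obtain ⟨y, rfl⟩ := proj_surjective y
      obtain ⟨a, rfl⟩ := proj_surjective a
      rw [← hzero ((proj_mul a y).trans hb), map_mul, hy y rfl, mul_zero]
    · rintro a y _ hy b hb
      obtain ⟨y, rfl⟩ := proj_surjective y
      obtain ⟨a, rfl⟩ := proj_surjective a
      rw [← hzero ((proj_mul y a).trans hb), map_mul, hy y rfl, zero_mul]
  refine ⟨_, isGradedIdeal_span_singleton (proj_single_mem_component x 1), ?_, ?_⟩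
  · intro h
    have h0 : E.proj R (MonoidAlgebra.single x 1) ∈ (⊥ : TwoSidedIdeal (LeavittPathRing R E)) :=
      h ▸ TwoSidedIdeal.subset_span rfl
    have h1 : E.proj R (MonoidAlgebra.single x 1) = E.proj R 0 := h0
    have h2 := ((E.relIdeal R).rel_iff _ _).1 (Quotient.exact h1)
    rw [sub_zero] at h2
    exact hS' ((S'.action_single_one R x).symm.trans (S'.action_eq_zero_of_mem_relIdeal h2))
  · intro h
    -- A vertex acts nontrivially: it fixes the value of the constant function 1 at `(v, 0)`.
    have h0 : S.action R (E.vertex R v) = 0 := key (h ▸ trivial)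
    have h1 := S.action_vertex_apply v (fun _ => (1 : R)) (v, 0)
    rw [h0, if_pos rfl] at h1
    exact zero_ne_one h1

end Grading

/-! ### Bijections onto strips with prescribed preimages -/

/-- The points of `ℕ × ℕ` with second coordinate less than `n`. -/
def strip (n : ℕ) : Set (ℕ × ℕ) := {q | q.2 < n}

theorem infinite_strip {n : ℕ} (hn : 0 < n) : (strip n).Infinite :=
  Set.infinite_of_injective_forall_mem (f := fun t : ℕ => (t, 0)) (fun _ _ h => congrArg Prod.fst h)
    fun _ => hn

theorem exists_injective_range_eq {ι α : Type*} [Countable ι] [Infinite ι] [Countable α]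
    {T : Set α} (hT : T.Infinite) : ∃ f : ι → α, Function.Injective f ∧ Set.range f = T := by
  have := hT.to_subtype
  obtain ⟨e⟩ := nonempty_equiv_of_countable (α := ι) (β := T)
  exact ⟨fun i => e i, Subtype.val_injective.comp e.injective,
    by rw [Set.range_comp' Subtype.val e, e.range_eq_univ, Set.image_univ, Subtype.range_coe]⟩

/-- Glue bijections `P → Q` and `Pᶜ → T \ Q`; all four sets are countably infinite. -/
theorem exists_injective_mem_iff {ι α : Type*} [Countable ι] [Countable α] {P : Set ι}
    {Q T : Set α} (hP : P.Infinite) (hP' : Pᶜ.Infinite) (hQ : Q.Infinite)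
    (hQ' : (T \ Q).Infinite) (hQT : Q ⊆ T) :
    ∃ f : ι → α, Function.Injective f ∧ Set.range f = T ∧ ∀ i, f i ∈ Q ↔ i ∈ P := by
  classical
  have := hP.to_subtype
  have := hP'.to_subtype
  obtain ⟨g, hg, hgQ⟩ := exists_injective_range_eq (ι := P) hQ
  obtain ⟨g', hg', hgQ'⟩ := exists_injective_range_eq (ι := ↥Pᶜ) hQ'
  have hgm (i) : g i ∈ Q := hgQ ▸ ⟨i, rfl⟩
  have hgm' (i) : g' i ∈ T \ Q := hgQ' ▸ ⟨i, rfl⟩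
  have key (i : ι) : (if h : i ∈ P then g ⟨i, h⟩ else g' ⟨i, h⟩) ∈ Q ↔ i ∈ P := by
    split_ifs with h
    · exact iff_of_true (hgm _) h
    · exact iff_of_false (hgm' _).2 h
  refine ⟨fun i => if h : i ∈ P then g ⟨i, h⟩ else g' ⟨i, h⟩, ?_, ?_, key⟩
  · intro i j hij
    have hiff : i ∈ P ↔ j ∈ P := by rw [← key i, ← key j]; exact iff_of_eq (congrArg (· ∈ Q) hij)
    dsimp only at hij
    by_cases h : i ∈ P
    · rw [dif_pos h, dif_pos (hiff.1 h)] at hij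
      exact congrArg Subtype.val (hg hij)
    · rw [dif_neg h, dif_neg (hiff.not.1 h)] at hij
      exact congrArg Subtype.val (hg' hij)
  · ext q
    constructor
    · rintro ⟨i, rfl⟩
      dsimp only
      split_ifs with h
      · exact hQT (hgm _)
      · exact (hgm' _).1
    · intro hq
      by_cases h : q ∈ Q
      · rw [← hgQ] at h
        obtain ⟨i, rfl⟩ := h
        exact ⟨i, dif_pos i.2⟩
      · have h' : q ∈ T \ Q := ⟨hq, h⟩
        rw [← hgQ'] at h'
        obtain ⟨i, rfl⟩ := h'
        exact ⟨i, dif_neg i.2⟩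

variable {E : WeightedGraph.{u, v}}

theorem weight_le_vertWeight (α : E.SEdge) : E.weight α ≤ E.vertWeight (E.src α) :=
  Finset.le_sup (mem_out.2 rfl)

theorem vertWeight_src_pos (α : E.SEdge) : 0 < E.vertWeight (E.src α) :=
  (E.weight_pos α).trans_le (weight_le_vertWeight α)

theorem exists_weight_eq_vertWeight (α : E.SEdge) :
    ∃ β, E.src β = E.src α ∧ E.weight β = E.vertWeight (E.src α) := by
  obtain ⟨β, hβ, h⟩ := Finset.exists_mem_eq_sup (E.out (E.src α)) ⟨α, mem_out.2 rfl⟩ E.weight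
  exact ⟨β, mem_out.1 hβ, h.symm⟩

theorem weight_eq_vertWeight_of_unique {α : E.SEdge} (h : ∀ β, E.src β = E.src α → β = α) :
    E.weight α = E.vertWeight (E.src α) := by
  obtain ⟨β, hβ, hw⟩ := exists_weight_eq_vertWeight α
  rwa [h β hβ] at hw

/-! ### Existence of local systems -/

namespace LocalSystem

/-- The local system at a vertex emitting a single structured edge given by a bijection. -/
def ofUnique (α : E.SEdge) (h : ∀ β, E.src β = E.src α → β = α) (f : ℕ → ℕ × ℕ)
    (hf : Function.Injective f) (hr : Set.range f = strip (E.vertWeight (E.src α))) :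
    LocalSystem E (E.src α) where
  toFun _ := f
  lt β t hβ := by
    rw [h β hβ, weight_eq_vertWeight_of_unique h]
    have : f t ∈ strip (E.vertWeight (E.src α)) := hr ▸ ⟨t, rfl⟩
    exact this
  inj β γ t t' hβ hγ htt := ⟨(h β hβ).trans (h γ hγ).symm, hf htt⟩
  surj s i hi := by
    have : (s, i) ∈ strip (E.vertWeight (E.src α)) := hi
    rw [← hr] at this
    obtain ⟨t, ht⟩ := this
    exact ⟨α, t, rfl, ht⟩

/-- At a vertex emitting a structured edge `α` of maximal weight and other structured edges, the
part of a local system not covered by `α` can be prescribed. -/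
theorem exists_of_ne {α β : E.SEdge} (hα : E.weight α = E.vertWeight (E.src α))
    (hβ : E.src β = E.src α) (hne : β ≠ α) {C : Set (ℕ × ℕ)} (hC0 : ∀ q ∈ C, q.2 = 0)
    (hC : C.Infinite) (hC' : (strip (E.vertWeight (E.src α)) \ C).Infinite) :
    ∃ L : LocalSystem E (E.src α),
      Set.range (L.toFun α) = strip (E.vertWeight (E.src α)) \ C := by
  classical
  have := E.countable_sedge
  let ι := {γ // E.src γ = E.src α ∧ γ ≠ α}
  have : Nonempty ι := ⟨⟨β, hβ, hne⟩⟩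
  obtain ⟨f, hf, hfr⟩ := exists_injective_range_eq (ι := ℕ) hC'
  obtain ⟨g, hg, hgr⟩ := exists_injective_range_eq (ι := ι × ℕ) hC
  have hfm (t) : f t ∈ strip (E.vertWeight (E.src α)) \ C := hfr ▸ ⟨t, rfl⟩
  have hgm (x) : g x ∈ C := hgr ▸ ⟨x, rfl⟩
  -- The edge `α` covers the strip minus `C`, which maximality of `ω(α)` permits. The other edges
  -- share `C`, whose points have index 0 and so fit any positive weight.
  refine ⟨⟨fun γ t => if h : E.src γ = E.src α ∧ γ ≠ α then g (⟨γ, h⟩, t) else f t,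
    ?_, ?_, ?_⟩, ?_⟩
  · intro γ t hγ
    split_ifs with h
    · rw [hC0 _ (hgm _)]
      exact E.weight_pos γ
    · obtain rfl : γ = α := by by_contra h'; exact h ⟨hγ, h'⟩
      rw [hα]
      exact (hfm t).1
  · intro γ δ t t' hγ hδ h
    split_ifs at h with h1 h2 h2
    · have := hg h
      exact ⟨congrArg (fun x => x.1.1) this, congrArg Prod.snd this⟩
    · exact ((hfm t').2 (h ▸ hgm _)).elim
    · exact ((hfm t).2 (h ▸ hgm _)).elim
    · obtain rfl : γ = α := by by_contra h'; exact h1 ⟨hγ, h'⟩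
      obtain rfl : δ = γ := by by_contra h'; exact h2 ⟨hδ, h'⟩
      exact ⟨rfl, hf h⟩
  · intro s i hi
    by_cases hq : (s, i) ∈ C
    · rw [← hgr] at hq
      obtain ⟨⟨γ, t⟩, h⟩ := hq
      exact ⟨γ, t, γ.2.1, by rw [dif_pos γ.2, h]⟩
    · have hq' : (s, i) ∈ strip (E.vertWeight (E.src α)) \ C := ⟨hi, hq⟩
      rw [← hfr] at hq'
      obtain ⟨t, h⟩ := hq'
      exact ⟨α, t, rfl, by rw [dif_neg fun h => h.2 rfl, h]⟩
  · refine Eq.trans (congrArg Set.range ?_) hfr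
    ext1 t
    exact dif_neg fun h => h.2 rfl

instance (v : E.Vert) : Nonempty (LocalSystem E v) := by
  by_cases hv : ∃ α, E.src α = v
  · obtain ⟨α, rfl⟩ := hv
    obtain ⟨α', hα', hw⟩ := exists_weight_eq_vertWeight α
    rw [← hα'] at hw ⊢
    by_cases h : ∀ β, E.src β = E.src α' → β = α'
    · obtain ⟨f, hf, hr⟩ := exists_injective_range_eq (ι := ℕ)
        (infinite_strip (vertWeight_src_pos α'))
      exact ⟨ofUnique α' h f hf hr⟩
    · push Not at h
      obtain ⟨β, hβ, hne⟩ := h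
      -- Any infinite subset of row 0 with infinite complement would do; the even points are one.
      obtain ⟨L, -⟩ := exists_of_ne hw hβ hne (C := Set.range fun n : ℕ => (2 * n, 0))
        (by rintro _ ⟨n, rfl⟩; rfl)
        (Set.infinite_range_of_injective fun m n h => by simpa using h)
        (Set.infinite_of_injective_forall_mem (f := fun n : ℕ => (2 * n + 1, 0))
          (fun m n h => by simpa using h) fun n => ⟨vertWeight_src_pos α', by
            rintro ⟨m, hm⟩
            have : 2 * m = 2 * n + 1 := congrArg Prod.fst hm
            lia⟩)
      exact ⟨L⟩
  · have h0 : E.vertWeight v = 0 := by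
      refine Nat.le_zero.1 (Finset.sup_le fun α hα => (hv ⟨α, mem_out.1 hα⟩).elim)
    exact ⟨⟨fun _ _ => 0, fun α _ h => (hv ⟨α, h⟩).elim, fun α _ _ _ h => (hv ⟨α, h⟩).elim,
      fun _ i hi => by omega⟩⟩

end LocalSystem

/-! ### Trails from weighted vertices and their words -/

/-- `IsTrail p v`: the list `p`, read backwards, is a path from a weighted vertex to `v`. -/
inductive IsTrail : List E.SEdge → E.Vert → Prop
  | nil {v : E.Vert} (hv : v ∈ E.weightedVerts) : IsTrail [] v
  | cons {p : List E.SEdge} {α : E.SEdge} (hp : IsTrail p (E.src α)) : IsTrail (α :: p) (E.rng α)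

theorem exists_isTrail_of_mem_weightForest {v : E.Vert} (hv : v ∈ E.weightForest) :
    ∃ p, IsTrail p v := by
  simp only [weightForest, Set.mem_iUnion] at hv
  obtain ⟨u, hu, huv⟩ := hv
  change Relation.ReflTransGen _ u v at huv
  induction huv with
  | refl => exact ⟨[], .nil hu⟩
  | tail _ h ih =>
    obtain ⟨p, hp⟩ := ih
    obtain ⟨α, rfl, rfl⟩ := h
    exact ⟨α :: p, hp.cons⟩

/-- Cutting the trail before `α` gives the shorter one. Applied to a shortest trail, this keeps the
trail away from the vertex where the local system is to be changed. -/
theorem IsTrail.exists_length_lt {p : List E.SEdge} {v : E.Vert} (hp : IsTrail p v) {α : E.SEdge}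
    (hα : α ∈ p) : ∃ q, IsTrail q (E.src α) ∧ q.length < p.length := by
  induction hp with
  | nil => simp at hα
  | @cons p β hp ih =>
    rcases List.mem_cons.1 hα with rfl | h
    · exact ⟨p, hp, by simp⟩
    · obtain ⟨q, hq, hl⟩ := ih h
      exact ⟨q, hq, hl.trans (by simp)⟩

theorem exists_isTrail_minimal {v : E.Vert} (hv : v ∈ E.weightForest) :
    ∃ p, IsTrail p v ∧ ∀ q, IsTrail q v → p.length ≤ q.length := by
  obtain ⟨p, hp⟩ := exists_isTrail_of_mem_weightForest hv
  obtain ⟨q, hq, hmin⟩ := (InvImage.wf List.length Nat.lt_wfRel.wf).has_min {q | IsTrail q v} ⟨p, hp⟩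
  exact ⟨q, hq, fun q' hq' => not_lt.1 (hmin q' hq')⟩

/-- The word `β₁ ⋯ γ₁ α₁`, where `p` is the list `γ, …, β`. -/
def edgeWord (α : E.SEdge) : List E.SEdge → FreeSemigroup E.Gen
  | [] => .of (.edge α ⟨0, E.weight_pos α⟩)
  | β :: p => edgeWord β p * .of (.edge α ⟨0, E.weight_pos α⟩)

/-- The word `α₁^* γ₁^* ⋯ β₁^*`, where `p` is the list `γ, …, β`. -/
def ghostWord (α : E.SEdge) : List E.SEdge → FreeSemigroup E.Gen
  | [] => .of (.ghost α ⟨0, E.weight_pos α⟩)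
  | β :: p => .of (.ghost α ⟨0, E.weight_pos α⟩) * ghostWord β p

/-! ### Marked points and the action of path words -/

namespace BranchingSystem

variable (S : BranchingSystem E)

/-- The set of points `(t, 0)` such that the path obtained by reading `p` backwards, with all
indices equal to `1`, can be followed to `t`. -/
def mark : List E.SEdge → Set (ℕ × ℕ)
  | [] => {q | q.2 = 0}
  | α :: p => {q | q.2 = 0 ∧ S.branch α q.1 ∈ mark p}

variable {S} in
theorem snd_eq_zero_of_mem_mark {p : List E.SEdge} {q : ℕ × ℕ} (hq : q ∈ S.mark p) : q.2 = 0 := by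
  cases p with
  | nil => exact hq
  | cons α p => exact hq.1

/-- The marks involve only the local systems at sources of edges of `p`, so the others may be
modified freely. -/
theorem mark_congr {S S' : BranchingSystem E} {p : List E.SEdge}
    (h : ∀ α ∈ p, S (E.src α) = S' (E.src α)) : S.mark p = S'.mark p := by
  induction p with
  | nil => rfl
  | cons α p ih =>
    rw [mark, mark, ih fun β hβ => h β (List.mem_cons_of_mem _ hβ)]
    simp only [branch, h α List.mem_cons_self]

theorem strip_subset_range_branch {α : E.SEdge} (h : ∀ β, E.src β = E.src α → β = α) :
    strip (E.vertWeight (E.src α)) ⊆ Set.range (S.branch α) := by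
  rintro ⟨s, i⟩ hq
  obtain ⟨β, t, hβ, ht⟩ := S.exists_branch_eq (E.src α) s i hq
  obtain rfl := h β hβ
  exact ⟨t, ht⟩

theorem mark_subset_strip (p : List E.SEdge) (α : E.SEdge) :
    S.mark p ⊆ strip (E.vertWeight (E.src α)) := fun q hq => by
  change q.2 < _
  rw [snd_eq_zero_of_mem_mark hq]
  exact vertWeight_src_pos α

/-- At the weighted start, row 0 is marked and row 1 is not, both infinite. Along an edge that is
alone at its source the branch covers the whole strip, so both infinitudes survive taking preimages.
-/
theorem infinite_mark {p : List E.SEdge} {v : E.Vert} (hp : IsTrail p v)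
    (h : ∀ α ∈ p, ∀ β, E.src β = E.src α → β = α) (hv : 0 < E.vertWeight v) :
    (S.mark p).Infinite ∧ (strip (E.vertWeight v) \ S.mark p).Infinite := by
  induction hp with
  | nil hw =>
    exact ⟨Set.infinite_of_injective_forall_mem (f := fun t : ℕ => (t, 0))
      (fun _ _ h => congrArg Prod.fst h) fun _ => rfl,
      Set.infinite_of_injective_forall_mem (f := fun t : ℕ => (t, 1))
      (fun _ _ h => congrArg Prod.fst h) fun _ => ⟨hw, one_ne_zero⟩⟩
  | @cons p α hp ih =>
    obtain ⟨h1, h2⟩ := ih (fun β hβ => h β (List.mem_cons_of_mem _ hβ)) (vertWeight_src_pos α)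
    have hr := S.strip_subset_range_branch (h α List.mem_cons_self)
    have hinj : Function.Injective fun t : ℕ => (t, 0) := fun _ _ h => congrArg Prod.fst h
    constructor
    · refine ((h1.preimage ((S.mark_subset_strip p α).trans hr)).image hinj.injOn).mono ?_
      rintro _ ⟨t, ht, rfl⟩
      exact ⟨rfl, ht⟩
    · refine ((h2.preimage (Set.sdiff_subset.trans hr)).image hinj.injOn).mono ?_
      rintro _ ⟨t, ht, rfl⟩
      exact ⟨hv, fun h => ht.2 h.2⟩

variable (R : Type w) [Ring R]

theorem wordAction_of_apply (x : E.Gen) (f : E.Vert × ℕ → R) (q : E.Vert × ℕ) :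
    S.wordAction R (.of x) f q = (S.step x q).elim 0 f := by
  rw [wordAction, FreeSemigroup.lift_of, pullback_apply]

theorem wordAction_mul_apply (x y : FreeSemigroup E.Gen) (f : E.Vert × ℕ → R) :
    S.wordAction R (x * y) f = S.wordAction R x (S.wordAction R y f) := by
  rw [map_mul]; rfl

variable {R}

/-- Pullback makes a point follow the letters from left to right. The witness `q` is the start of
the path ending at `(E.rng α, t)`, and the marks record that such a path exists. -/
theorem exists_wordAction_edgeWord_apply {p : List E.SEdge} {α : E.SEdge}
    (hp : IsTrail p (E.src α)) {t : ℕ} (ht : S.branch α t ∈ S.mark p) :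
    ∃ q, ∀ f : E.Vert × ℕ → R, S.wordAction R (edgeWord α p) f q = f (E.rng α, t) := by
  have h0 (f : E.Vert × ℕ → R) : S.wordAction R (.of (.edge α ⟨0, E.weight_pos α⟩)) f
      (E.src α, (S.branch α t).1) = f (E.rng α, t) := by
    rw [wordAction_of_apply, (S.step_edge_eq_some (q := (E.rng α, t))).2
      ⟨rfl, rfl, Prod.ext rfl (snd_eq_zero_of_mem_mark ht)⟩, Option.elim_some]
  induction p generalizing α t with
  | nil => exact ⟨_, h0⟩
  | cons β p ih =>
    have hp' : IsTrail p (E.src β) ∧ E.rng β = E.src α := by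
      generalize hv : E.src α = v at hp
      cases hp with
      | cons hp => exact ⟨hp, rfl⟩
    obtain ⟨q, hq⟩ := ih hp'.1 ht.2 fun f => by
      rw [wordAction_of_apply, (S.step_edge_eq_some (q := (E.rng β, _))).2
        ⟨rfl, rfl, Prod.ext rfl (snd_eq_zero_of_mem_mark ht.2)⟩, Option.elim_some]
    refine ⟨q, fun f => ?_⟩
    rw [edgeWord, wordAction_mul_apply, hq, hp'.2, h0]

/-- Every point that survives the whole word ends at some `(E.rng α, t)` with marked branch, so only
values of `f` there are ever read. -/
theorem wordAction_edgeWord_eq_zero {p : List E.SEdge} {α : E.SEdge}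
    (hp : IsTrail p (E.src α)) {f : E.Vert × ℕ → R}
    (hf : ∀ t, S.branch α t ∈ S.mark p → f (E.rng α, t) = 0) :
    S.wordAction R (edgeWord α p) f = 0 := by
  have h0 (s : ℕ) (hs : (s, 0) ∈ S.mark p) (u : E.Vert) :
      S.wordAction R (.of (.edge α ⟨0, E.weight_pos α⟩)) f (u, s) = 0 := by
    rw [wordAction_of_apply]
    cases hq : S.step (.edge α ⟨0, E.weight_pos α⟩) (u, s) with
    | none => rfl
    | some q =>
      obtain ⟨-, h1, h2⟩ := S.step_edge_eq_some.1 hq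
      rw [Option.elim_some]
      obtain ⟨u', t⟩ := q
      obtain rfl : u' = E.rng α := h1
      exact hf t (h2 ▸ hs)
  induction p generalizing α f with
  | nil => exact funext fun q => h0 q.2 rfl q.1
  | cons β p ih =>
    have hp' : IsTrail p (E.src β) := by
      generalize hv : E.src α = v at hp
      cases hp with
      | cons hp => exact hp
    rw [edgeWord, wordAction_mul_apply]
    have hβ (t) (ht : S.branch β t ∈ S.mark p) :
        S.wordAction R (.of (.edge α ⟨0, E.weight_pos α⟩)) f (E.rng β, t) = 0 :=
      h0 t ⟨rfl, ht⟩ _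
    refine ih hp' hβ fun s hs u => ?_
    rw [wordAction_of_apply]
    cases hq : S.step (.edge β ⟨0, E.weight_pos β⟩) (u, s) with
    | none => rfl
    | some q =>
      obtain ⟨-, h1, h2⟩ := S.step_edge_eq_some.1 hq
      rw [Option.elim_some]
      obtain ⟨u', t⟩ := q
      obtain rfl : u' = E.rng β := h1
      exact hβ t (h2 ▸ hs)

theorem exists_wordAction_ghostWord_apply {p : List E.SEdge} {α : E.SEdge}
    (hp : IsTrail p (E.src α)) {t : ℕ} (ht : S.branch α t ∈ S.mark p) :
    ∃ q, ∀ f : E.Vert × ℕ → R, S.wordAction R (ghostWord α p) f (E.rng α, t) = f q := by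
  have h0 (f : E.Vert × ℕ → R) : S.wordAction R (.of (.ghost α ⟨0, E.weight_pos α⟩)) f
      (E.rng α, t) = f (E.src α, (S.branch α t).1) := by
    rw [wordAction_of_apply, (S.step_ghost_eq_some (q := (E.src α, (S.branch α t).1))).2
      ⟨rfl, rfl, Prod.ext rfl (snd_eq_zero_of_mem_mark ht)⟩, Option.elim_some]
  induction p generalizing α t with
  | nil => exact ⟨_, h0⟩
  | cons β p ih =>
    have hp' : IsTrail p (E.src β) ∧ E.rng β = E.src α := by
      generalize hv : E.src α = v at hp
      cases hp with
      | cons hp => exact ⟨hp, rfl⟩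
    obtain ⟨q, hq⟩ := ih hp'.1 ht.2 fun f => by
      rw [wordAction_of_apply, (S.step_ghost_eq_some (q := (E.src β, _))).2
        ⟨rfl, rfl, Prod.ext rfl (snd_eq_zero_of_mem_mark ht.2)⟩, Option.elim_some]
    refine ⟨q, fun f => ?_⟩
    rw [ghostWord, wordAction_mul_apply, h0, ← hp'.2, hq]

/-- Ghost edges retrace the trail backwards; an unmarked point gets stuck at some letter. -/
theorem wordAction_ghostWord_apply_eq_zero {p : List E.SEdge} {α : E.SEdge}
    (hp : IsTrail p (E.src α)) {t : ℕ} (ht : S.branch α t ∉ S.mark p) (f : E.Vert × ℕ → R) :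
    S.wordAction R (ghostWord α p) f (E.rng α, t) = 0 := by
  induction p generalizing α t with
  | nil =>
    rw [ghostWord, wordAction_of_apply, step, if_neg fun h => ht h.2, Option.elim_none]
  | cons β p ih =>
    have hp' : IsTrail p (E.src β) ∧ E.rng β = E.src α := by
      generalize hv : E.src α = v at hp
      cases hp with
      | cons hp => exact ⟨hp, rfl⟩
    rw [ghostWord, wordAction_mul_apply, wordAction_of_apply, step]
    split_ifs with h
    · rw [Option.elim_some, ← hp'.2]
      exact ih hp'.1 fun h' => ht ⟨h.2, h'⟩
    · rw [Option.elim_none]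

end BranchingSystem

/-! ### The two ways the forest condition fails -/

section ProperIdeal

variable {E : WeightedGraph.{u, v}} {R : Type w} [Ring R] [Nontrivial R]

open BranchingSystem

/-- If a vertex of the weight forest emits two structured edges, there is a proper graded ideal. -/
theorem exists_properIdeal_of_branching {p : List E.SEdge} {α β : E.SEdge}
    (hp : IsTrail p (E.src α)) (hβ : E.src β = E.src α) (hne : β ≠ α)
    (hα : E.weight α = E.vertWeight (E.src α)) (hpα : ∀ γ ∈ p, E.src γ ≠ E.src α)
    (huniq : ∀ γ ∈ p, ∀ δ, E.src δ = E.src γ → δ = γ) :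
    ∃ J : TwoSidedIdeal (LeavittPathRing R E), E.IsGradedIdeal J ∧ E.IsProperIdeal J := by
  classical
  let S : BranchingSystem E := fun _ => Classical.arbitrary _
  have hS (L : LocalSystem E (E.src α)) :
      BranchingSystem.mark (Function.update S (E.src α) L) p = S.mark p :=
    mark_congr fun γ hγ => Function.update_of_ne (hpα γ hγ) _ _
  have hL (L : LocalSystem E (E.src α)) :
      BranchingSystem.branch (Function.update S (E.src α) L) α = L.toFun α := by
    funext t
    rw [branch, Function.update_self]
  obtain ⟨h1, h2⟩ := S.infinite_mark hp huniq (vertWeight_src_pos α)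
  -- With `L` the edge `α` avoids every marked point, so the word dies; with `L'` one marked point
  -- `c` is returned to `α`, so the word survives.
  obtain ⟨L, hLr⟩ := LocalSystem.exists_of_ne hα hβ hne
    (fun _ => snd_eq_zero_of_mem_mark) h1 h2
  obtain ⟨c, hc⟩ := h1.nonempty
  obtain ⟨L', hLr'⟩ := LocalSystem.exists_of_ne hα hβ hne (C := S.mark p \ {c})
    (fun _ hq => snd_eq_zero_of_mem_mark hq.1) (h1.sdiff (Set.finite_singleton c))
    (h2.mono (Set.sdiff_subset_sdiff_right Set.sdiff_subset))
  obtain ⟨t, ht⟩ : c ∈ Set.range (L'.toFun α) :=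
    hLr' ▸ ⟨S.mark_subset_strip p α hc, fun h => h.2 rfl⟩
  refine exists_isGradedIdeal_isProperIdeal (E.src α) (Function.update S _ L)
    (Function.update S _ L') (edgeWord α p) ?_ ?_
  · ext f q
    rw [wordAction_edgeWord_eq_zero _ hp]
    · rfl
    · intro t' ht'
      rw [hS, hL] at ht'
      have : L.toFun α t' ∈ strip (E.vertWeight (E.src α)) \ S.mark p := hLr ▸ ⟨t', rfl⟩
      exact (this.2 ht').elim
  · intro h
    obtain ⟨q, hq⟩ := exists_wordAction_edgeWord_apply (R := R) (Function.update S _ L') hp (t := t)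
      (by rw [hS, hL, ht]; exact hc)
    have := hq fun _ => 1
    rw [h] at this
    exact zero_ne_one this

/-- If no vertex of the weight forest emits two structured edges, but two structured edges starting
in it have the same range, there is a proper graded ideal. -/
theorem exists_properIdeal_of_merging {p p' : List E.SEdge} {α β : E.SEdge}
    (hp : IsTrail p (E.src α)) (hp' : IsTrail p' (E.src β)) (hne : α ≠ β)
    (hr : E.rng α = E.rng β) (hmin : ∀ q, IsTrail q (E.src β) → p'.length ≤ q.length)
    (hle : p.length ≤ p'.length)
    (huniq : ∀ q γ, IsTrail q (E.src γ) → ∀ δ, E.src δ = E.src γ → δ = γ) :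
    ∃ J : TwoSidedIdeal (LeavittPathRing R E), E.IsGradedIdeal J ∧ E.IsProperIdeal J := by
  classical
  let S : BranchingSystem E := fun _ => Classical.arbitrary _
  have hsrc : E.src α ≠ E.src β := fun h => hne (huniq p' β hp' α h)
  have hlt {q : List E.SEdge} {v : E.Vert} (hq : IsTrail q v) (hl : q.length ≤ p'.length) :
      ∀ γ ∈ q, E.src γ ≠ E.src β := by
    intro γ hγ h
    obtain ⟨q', hq', hl'⟩ := hq.exists_length_lt hγ
    -- A trail no longer than `p'` cannot leave `E.src β`: its initial piece would be a trail to
    -- that vertex shorter than the minimal `p'`. Hence the marks of `p` and `p'` ignore the local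
    -- system there.
    exact absurd (hmin q' (h ▸ hq')) (by lia)
  have hu {q : List E.SEdge} {v : E.Vert} (hq : IsTrail q v) :
      ∀ γ ∈ q, ∀ δ, E.src δ = E.src γ → δ = γ := by
    intro γ hγ
    obtain ⟨q', hq', -⟩ := hq.exists_length_lt hγ
    exact huniq q' γ hq'
  have hS (L : LocalSystem E (E.src β)) {q : List E.SEdge} {v : E.Vert} (hq : IsTrail q v)
      (hl : q.length ≤ p'.length) :
      BranchingSystem.mark (Function.update S (E.src β) L) q = S.mark q :=
    mark_congr fun γ hγ => Function.update_of_ne (hlt hq hl γ hγ) _ _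
  have hLα (L : LocalSystem E (E.src β)) :
      BranchingSystem.branch (Function.update S (E.src β) L) α = S.branch α := by
    funext t
    rw [branch, Function.update_of_ne hsrc, branch]
  have hLβ (L : LocalSystem E (E.src β)) :
      BranchingSystem.branch (Function.update S (E.src β) L) β = L.toFun β := by
    funext t
    rw [branch, Function.update_self]
  obtain ⟨h1, h2⟩ := S.infinite_mark hp (hu hp) (vertWeight_src_pos α)
  obtain ⟨h1', h2'⟩ := S.infinite_mark hp' (hu hp') (vertWeight_src_pos β)
  have hrange := S.strip_subset_range_branch (huniq p α hp)
  have hP : (S.branch α ⁻¹' S.mark p).Infinite :=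
    h1.preimage ((S.mark_subset_strip p α).trans hrange)
  have hP' : (S.branch α ⁻¹' S.mark p)ᶜ.Infinite :=
    (h2.preimage (Set.sdiff_subset.trans hrange)).mono fun t ht => ht.2
  have hsub := S.mark_subset_strip p' β
  -- Points reached through `α` are exactly those not reached through `β` for `f`, and exactly those
  -- reached through `β` for `f'`. So the product of the two path words is zero for `f` and nonzero
  -- for `f'`.
  obtain ⟨f, hf, hfr, hfm⟩ := exists_injective_mem_iff hP hP' h2'
    (by rwa [Set.sdiff_sdiff_cancel_left hsub]) Set.sdiff_subset
  obtain ⟨f', hf', hfr', hfm'⟩ := exists_injective_mem_iff hP hP' h1' h2' hsub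
  let L := LocalSystem.ofUnique β (huniq p' β hp') f hf hfr
  let L' := LocalSystem.ofUnique β (huniq p' β hp') f' hf' hfr'
  refine exists_isGradedIdeal_isProperIdeal (E.src α) (Function.update S _ L)
    (Function.update S _ L') (edgeWord α p * ghostWord β p') ?_ ?_
  · ext φ q
    rw [wordAction_mul_apply, wordAction_edgeWord_eq_zero _ hp]
    · rfl
    · intro t ht
      rw [hS L hp hle, hLα] at ht
      rw [hr]
      refine wordAction_ghostWord_apply_eq_zero _ hp' ?_ φ
      rw [hS L hp' le_rfl, hLβ]
      exact ((hfm t).2 ht).2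
  · intro h
    obtain ⟨t, ht⟩ := hP.nonempty
    obtain ⟨q, hq⟩ := exists_wordAction_edgeWord_apply (R := R) (Function.update S _ L') hp (t := t)
      (by rw [hS L' hp hle, hLα]; exact ht)
    obtain ⟨q', hq'⟩ := exists_wordAction_ghostWord_apply (R := R) (Function.update S _ L') hp'
      (t := t) (by rw [hS L' hp' le_rfl, hLβ]; exact (hfm' t).2 ht)
    have := hq (BranchingSystem.wordAction (Function.update S _ L') R (ghostWord β p') fun _ => 1)
    rw [← wordAction_mul_apply, h, hr, hq'] at this
    exact zero_ne_one this

theorem exists_properIdeal_of_not_forestCondition (hE : ¬ E.ForestCondition) :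
    ∃ J : TwoSidedIdeal (LeavittPathRing R E), E.IsGradedIdeal J ∧ E.IsProperIdeal J := by
  by_cases hb : ∃ p α β, IsTrail (E := E) p (E.src α) ∧ E.src β = E.src α ∧ β ≠ α
  · have hwf := (InvImage.wf (List.length (α := E.SEdge)) Nat.lt_wfRel.wf).has_min
      {p | ∃ α β, IsTrail (E := E) p (E.src α) ∧ E.src β = E.src α ∧ β ≠ α} hb
    obtain ⟨p, ⟨α, β, hp, hβ, hne⟩, hmin⟩ := hwf
    have hmin' {q : List E.SEdge} {γ δ : E.SEdge} (hq : IsTrail q (E.src γ))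
        (hl : q.length < p.length) (hδ : E.src δ = E.src γ) : δ = γ := by
      by_contra h
      exact hmin q ⟨γ, δ, hq, hδ, h⟩ hl
    have huniq : ∀ γ ∈ p, ∀ δ, E.src δ = E.src γ → δ = γ := by
      intro γ hγ δ hδ
      obtain ⟨q, hq, hl⟩ := hp.exists_length_lt hγ
      exact hmin' hq hl hδ
    have hpα : ∀ γ ∈ p, E.src γ ≠ E.src α := by
      intro γ hγ h
      exact hne ((huniq γ hγ β (hβ.trans h.symm)).trans (huniq γ hγ α h.symm).symm)
    -- The edge appended to the trail must have maximal weight; at least one of `α`, `β` differs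
    -- from it.
    obtain ⟨α', hα', hw⟩ := exists_weight_eq_vertWeight α
    obtain ⟨β', hβ', hne'⟩ : ∃ β', E.src β' = E.src α' ∧ β' ≠ α' := by
      by_cases h : β = α'
      · exact ⟨α, hα'.symm, fun h' => hne (h.trans h'.symm)⟩
      · exact ⟨β, hβ.trans hα'.symm, h⟩
    rw [← hα'] at hw hp hpα
    exact exists_properIdeal_of_branching hp hβ' hne' hw hpα huniq
  · have huniq : ∀ q γ, IsTrail (E := E) q (E.src γ) → ∀ δ, E.src δ = E.src γ → δ = γ := by
      intro q γ hq δ hδ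
      by_contra h
      exact hb ⟨q, γ, δ, hq, hδ, h⟩
    rw [ForestCondition] at hE
    push Not at hE
    obtain ⟨v, hv, h⟩ := hE
    have hv1 : (E.src ⁻¹' {v}).encard ≤ 1 := by
      refine Set.encard_le_one_iff.2 fun α β hα hβ => ?_
      obtain rfl : E.src β = v := hβ
      obtain ⟨q, hq⟩ := exists_isTrail_of_mem_weightForest hv
      exact huniq q β hq α hα
    have h2 := not_le.2 (h hv1)
    rw [Set.encard_le_one_iff] at h2
    push Not at h2
    obtain ⟨α, β, ⟨hα, hαW⟩, ⟨hβ, hβW⟩, hne⟩ := h2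
    have hr : E.rng α = E.rng β := Eq.trans hα (Eq.symm hβ)
    obtain ⟨p, hp, hpmin⟩ := exists_isTrail_minimal hαW
    obtain ⟨p', hp', hpmin'⟩ := exists_isTrail_minimal hβW
    rcases le_total p.length p'.length with hle | hle
    · exact exists_properIdeal_of_merging hp hp' hne hr hpmin' hle huniq
    · exact exists_properIdeal_of_merging hp' hp hne.symm hr.symm hpmin hle huniq

end ProperIdeal

end WeightedGraph

theorem mainTheorem7 (E : WeightedGraph.{u, v}) (hE : E.IsIrreducible) (R : Type w) [Ring R] :
    ¬ E.IsGradedSimple R ∧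
      (Nontrivial R → ∃ J : TwoSidedIdeal (WeightedGraph.LeavittPathRing R E),
        E.IsGradedIdeal J ∧ E.IsProperIdeal J) := by
  have key (_ : Nontrivial R) : ∃ J : TwoSidedIdeal (WeightedGraph.LeavittPathRing R E),
      E.IsGradedIdeal J ∧ E.IsProperIdeal J :=
    WeightedGraph.exists_properIdeal_of_not_forestCondition fun h => hE.2 ⟨hE.1, h⟩
  refine ⟨fun h => ?_, key⟩
  rcases subsingleton_or_nontrivial R with hR | hR
  -- Over the zero ring the algebra is zero, so its multiplication vanishes identically.
  · obtain ⟨⟨a, b, hab⟩, -⟩ := h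
    refine hab ?_
    rw [← one_smul R (a * b), Subsingleton.elim (1 : R) 0, zero_smul]
  · exact h.2 (key hR)
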